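/- Let $n_{1+},n_{1-},n_{2+},n_{2-}$ be non-negative integers, $n_1=n_{1+}+n_{1-}\ge 2$, $n_2=n_{2+}+n_{2-}$ with $n_1\le n_2$, let $\delta\in(0,2)$, $p\in(0,1/2)$, and let $\eta_1\in\{\pm1\}^{n_1}$, $\eta_2\in\{\pm1\}^{n_2}$ be label vectors such that $\eta_i$ has $n_{i+}$ entries $+1$ and $n_{i-}$ entries $-1$ ($i=1,2$). Assume that $|n_{i+}-n_{i-}|/n_i\le\gamma_i$ for some $\gamma_i\in(0,1)$, $i=1,2$. Let $A$ be drawn from the bipartite stochastic block model $BSBM(\delta,n_{1+},n_{1-},n_{2+},n_{2-},p)$, that is, $A$ is a random $n_1\times n_2$ matrix with independent entries such that $A_{ij}$ is Bernoulli with parameter $\delta p$ if $\eta_{1i}=\eta_{2j}$ and Bernoulli with parameter $(2-\delta)p$ if $\eta_{1i}\ne\eta_{2j}$. Set $W=A-\mathbb{E}(A)$, and let $\|\cdot\|_\infty$ denote the spectral norm of a matrix. If $$n_2\ge n_1\log n_1\qquad\text{and}\qquad 18\sqrt{\frac{\log n_1}{n_1n_2}}\le p\le\frac{1}{206\,n_1\log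 n_1},$$ then $$\mathbb{E}\left(\left\|WW^\top-\mathbb{E}(WW^\top)\right\|_\infty^2\right)\ge\frac{n_2p}{40}.$$ -/

import Mathlib

open MeasureTheory ProbabilityTheory
open scoped Matrix Matrix.Norms.L2Operator

/-- The real random variable `X` has the Bernoulli distribution `Ber(q)`:
value `1` with probability `q` and value `0` with probability `1 - q`. -/
def IsBernoulli {Ω : Type*} [MeasurableSpace Ω] (X : Ω → ℝ) (q : ℝ) (P : Measure Ω) : Prop :=
  ∃ hq : q ∈ Set.Icc (0 : ℝ) 1, HasLaw X (bernoulliMeasure (1 : ℝ) 0 ⟨q, hq⟩) P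

/-- The expectation of a random matrix, taken entry by entry. -/
noncomputable def matrixExpectation {Ω : Type*} [MeasurableSpace Ω] {m n : ℕ}
    (P : Measure Ω) (M : Ω → Matrix (Fin m) (Fin n) ℝ) : Matrix (Fin m) (Fin n) ℝ :=
  Matrix.of fun i j => ∫ ω, M ω i j ∂P

/-- `A` is a biadjacency matrix drawn according to the bipartite stochastic block model
`BSBM(δ, n₁₊, n₁₋, n₂₊, n₂₋, p)` with vertex sets `V₁ = Fin n₁`, `V₂ = Fin n₂` and label vectors
`η₁`, `η₂` with values in `{1, -1}`. (The cardinality fields force `n₁ = n₁₊ + n₁₋` and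
`n₂ = n₂₊ + n₂₋`.) -/
structure IsBSBM {Ω : Type*} [MeasurableSpace Ω] {n₁ n₂ : ℕ} (P : Measure Ω)
    (δ : ℝ) (n₁p n₁m n₂p n₂m : ℕ) (p : ℝ) (η₁ : Fin n₁ → ℤˣ) (η₂ : Fin n₂ → ℤˣ)
    (A : Ω → Matrix (Fin n₁) (Fin n₂) ℝ) : Prop where
  card_left_plus : (Finset.univ.filter fun i => η₁ i = 1).card = n₁p
  card_left_minus : (Finset.univ.filter fun i => η₁ i = -1).card = n₁m
  card_right_plus : (Finset.univ.filter fun j => η₂ j = 1).card = n₂p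
  card_right_minus : (Finset.univ.filter fun j => η₂ j = -1).card = n₂m
  indep : iIndepFun (fun (e : Fin n₁ × Fin n₂) (ω : Ω) => A ω e.1 e.2) P
  law_same : ∀ i j, η₁ i = η₂ j → IsBernoulli (fun ω => A ω i j) (δ * p) P
  law_diff : ∀ i j, η₁ i ≠ η₂ j → IsBernoulli (fun ω => A ω i j) ((2 - δ) * p) P

/-- The noise matrix `W = A - 𝔼 A`. -/
noncomputable def noiseMatrix {Ω : Type*} [MeasurableSpace Ω] {m n : ℕ}
    (P : Measure Ω) (A : Ω → Matrix (Fin m) (Fin n) ℝ) (ω : Ω) : Matrix (Fin m) (Fin n) ℝ :=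
  A ω - matrixExpectation P A

/-- The Gram matrix `W Wᵀ` of the noise matrix. -/
noncomputable def noiseGram {Ω : Type*} [MeasurableSpace Ω] {m n : ℕ}
    (P : Measure Ω) (A : Ω → Matrix (Fin m) (Fin n) ℝ) (ω : Ω) : Matrix (Fin m) (Fin m) ℝ :=
  noiseMatrix P A ω * (noiseMatrix P A ω)ᵀ

/-! The spectral norm dominates every diagonal entry, so the expectation is at least the variance of
any single diagonal entry of the Gram matrix. That entry is a sum over a row of independent terms
`(A i j - q i j) ^ 2`; each is a.s. affine in `A i j`, which gives its variance exactly, and for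
small `q` this is at least `q / 40`. Hence every row sum of the `q i j`, divided by 40, is a lower
bound. One row may have small mean when `δ` is near 0 or 2, but two rows with opposite labels have
means adding to `2 * p` in every column, so averaging their bounds gives the claim. -/

namespace IsBernoulli

variable {Ω : Type*} [MeasurableSpace Ω] {P : Measure Ω} {X : Ω → ℝ} {q : ℝ}

lemma aemeasurable (h : IsBernoulli X q P) : AEMeasurable X P :=
  h.choose_spec.aemeasurable

lemma ae_eq_one_or_zero (h : IsBernoulli X q P) : ∀ᵐ ω ∂P, X ω = 1 ∨ X ω = 0 := by
  obtain ⟨hq, h⟩ := h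
  have hm : MeasurableSet {x : ℝ | x = 1 ∨ x = 0} :=
    (measurableSet_singleton 1).union (measurableSet_singleton 0)
  rw [h.ae_iff (p := fun x => x = 1 ∨ x = 0) (measurableSet_setOfPred.1 hm), bernoulliMeasure_def,
    ae_add_measure_iff]
  constructor <;> refine Measure.ae_smul_measure ?_ _ <;> rw [ae_dirac_iff hm] <;> simp

lemma integral_eq (h : IsBernoulli X q P) : ∫ ω, X ω ∂P = q := by
  obtain ⟨hq, h⟩ := h
  rw [h.integral_eq, integral_bernoulliMeasure]
  simp

lemma memLp [IsProbabilityMeasure P] (h : IsBernoulli X q P) (r : ENNReal) : MemLp X r P := by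
  refine MemLp.of_bound h.aemeasurable.aestronglyMeasurable 1 ?_
  filter_upwards [h.ae_eq_one_or_zero] with ω hω
  rcases hω with hω | hω <;> simp [hω]

lemma variance_eq [IsProbabilityMeasure P] (h : IsBernoulli X q P) :
    variance X P = q * (1 - q) := by
  have hsq : ∫ ω, (X ^ 2) ω ∂P = ∫ ω, X ω ∂P := by
    refine integral_congr_ae ?_
    filter_upwards [h.ae_eq_one_or_zero] with ω hω
    rcases hω with hω | hω <;> simp [hω]
  rw [variance_eq_sub (h.memLp 2), hsq, h.integral_eq]
  ring

/-- Since `X ^ 2 = X` almost surely, the square is affine in `X`. -/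
lemma sq_sub_ae_eq (h : IsBernoulli X q P) (c : ℝ) :
    (fun ω => (X ω - c) ^ 2) =ᵐ[P] fun ω => (1 - 2 * c) * X ω + c ^ 2 := by
  filter_upwards [h.ae_eq_one_or_zero] with ω hω
  rcases hω with hω | hω <;> simp only [hω] <;> ring

lemma memLp_sq_sub [IsProbabilityMeasure P] (h : IsBernoulli X q P) (c : ℝ) (r : ENNReal) :
    MemLp (fun ω => (X ω - c) ^ 2) r P :=
  (memLp_congr_ae (h.sq_sub_ae_eq c)).2 (((h.memLp r).const_mul _).add (memLp_const _))

lemma variance_sq_sub [IsProbabilityMeasure P] (h : IsBernoulli X q P) (c : ℝ) :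
    variance (fun ω => (X ω - c) ^ 2) P = (1 - 2 * c) ^ 2 * (q * (1 - q)) := by
  rw [variance_congr (h.sq_sub_ae_eq c),
    variance_add_const (h.aemeasurable.const_mul _).aestronglyMeasurable, variance_const_mul,
    h.variance_eq]

end IsBernoulli

lemma abs_entry_le_l2_opNorm {m n : ℕ} (M : Matrix (Fin m) (Fin n) ℝ) (i : Fin m) (j : Fin n) :
    |M i j| ≤ ‖M‖ := by
  have h := Matrix.l2_opNorm_mulVec M (EuclideanSpace.single j (1 : ℝ))
  have h' := PiLp.norm_apply_le (WithLp.toLp 2 (M *ᵥ (EuclideanSpace.single j (1 : ℝ)).ofLp) :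
    EuclideanSpace ℝ (Fin m)) i
  simp only [PiLp.norm_single, norm_one, mul_one] at h
  simpa [Matrix.mulVec_single] using h'.trans h

/-- The entries lie a.s. in a compact cube, on which `f` is bounded. -/
lemma integrable_continuous_comp {Ω : Type*} [MeasurableSpace Ω] {P : Measure Ω}
    [IsProbabilityMeasure P] {m n : ℕ} {A : Ω → Matrix (Fin m) (Fin n) ℝ}
    (hm : ∀ i j, AEMeasurable (fun ω => A ω i j) P)
    (hb : ∀ i j, ∀ᵐ ω ∂P, A ω i j ∈ Set.Icc (0 : ℝ) 1)
    {f : Matrix (Fin m) (Fin n) ℝ → ℝ} (hf : Continuous f) :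
    Integrable (fun ω => f (A ω)) P := by
  let g : (Fin m → Fin n → ℝ) → ℝ := fun x => f (Matrix.of x)
  have hg : Continuous g := hf.comp continuous_id
  obtain ⟨C, hC⟩ := (isCompact_univ_pi fun _ : Fin m => isCompact_univ_pi fun _ : Fin n =>
    isCompact_Icc (a := (0 : ℝ)) (b := 1)).exists_bound_of_continuousOn hg.continuousOn
  have hAm : AEMeasurable (fun ω i j => A ω i j) P :=
    aemeasurable_pi_iff.2 fun i => aemeasurable_pi_iff.2 fun j => hm i j
  refine Integrable.of_bound (hg.measurable.comp_aemeasurable hAm).aestronglyMeasurable C ?_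
  filter_upwards [ae_all_iff.2 fun i => ae_all_iff.2 fun j => hb i j] with ω hω
  exact hC (fun i j => A ω i j) fun i _ j _ => hω i j

section noise

variable {Ω : Type*} [MeasurableSpace Ω] {P : Measure Ω} {m n : ℕ}
  {A : Ω → Matrix (Fin m) (Fin n) ℝ} {q : Fin m → Fin n → ℝ}

lemma noiseGram_diag (hA : ∀ i j, IsBernoulli (fun ω => A ω i j) (q i j) P) (ω : Ω) (i : Fin m) :
    noiseGram P A ω i i = ∑ j, (A ω i j - q i j) ^ 2 := by
  simp [noiseGram, noiseMatrix, matrixExpectation, Matrix.mul_apply, (hA _ _).integral_eq, sq]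

variable [IsProbabilityMeasure P]

lemma integrable_norm_noiseGram_sub_sq
    (hA : ∀ i j, IsBernoulli (fun ω => A ω i j) (q i j) P) (E : Matrix (Fin m) (Fin m) ℝ) :
    Integrable (fun ω => ‖noiseGram P A ω - E‖ ^ 2) P := by
  refine integrable_continuous_comp (fun i j => (hA i j).aemeasurable) (fun i j => ?_)
    (f := fun X => ‖(X - matrixExpectation P A) * (X - matrixExpectation P A)ᵀ - E‖ ^ 2) ?_
  · filter_upwards [(hA i j).ae_eq_one_or_zero] with ω hω
    rcases hω with hω | hω <;> simp [hω]
  · have h : Continuous fun X : Matrix (Fin m) (Fin n) ℝ =>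
        (X - matrixExpectation P A) * (X - matrixExpectation P A)ᵀ - E := by fun_prop
    exact (continuous_norm.comp h).pow 2

lemma integral_noiseGram_diag_sub_sq (hA : ∀ i j, IsBernoulli (fun ω => A ω i j) (q i j) P)
    (hind : iIndepFun (fun (e : Fin m × Fin n) (ω : Ω) => A ω e.1 e.2) P) (i : Fin m) :
    ∫ ω, (noiseGram P A ω i i - matrixExpectation P (noiseGram P A) i i) ^ 2 ∂P =
      ∑ j, (1 - 2 * q i j) ^ 2 * (q i j * (1 - q i j)) := by
  have hmem : ∀ j, MemLp (fun ω => (A ω i j - q i j) ^ 2) 2 P :=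
    fun j => (hA i j).memLp_sq_sub _ _
  have hpair : ∀ j k, j ≠ k →
      IndepFun (fun ω => (A ω i j - q i j) ^ 2) (fun ω => (A ω i k - q i k) ^ 2) P :=
    fun j k hjk => (hind.indepFun (i := (i, j)) (j := (i, k)) (by simpa using hjk)).comp
      (φ := fun x => (x - q i j) ^ 2) (ψ := fun x => (x - q i k) ^ 2) (by fun_prop) (by fun_prop)
  have hvar := IndepFun.variance_sum (μ := P) (s := Finset.univ)
    (X := fun j ω => (A ω i j - q i j) ^ 2) (fun j _ => hmem j) (fun j _ k _ hjk => hpair j k hjk)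
  simp only [(hA _ _).variance_sq_sub] at hvar
  rw [← hvar, variance_eq_integral (Finset.aemeasurable_sum _ fun j _ =>
    (hmem j).aestronglyMeasurable.aemeasurable)]
  simp [matrixExpectation, noiseGram_diag hA]

/-- The fluctuation of a single diagonal entry bounds that of the whole Gram matrix. -/
lemma sum_variance_le_integral_norm_sq (hA : ∀ i j, IsBernoulli (fun ω => A ω i j) (q i j) P)
    (hind : iIndepFun (fun (e : Fin m × Fin n) (ω : Ω) => A ω e.1 e.2) P) (i : Fin m) :
    ∑ j, (1 - 2 * q i j) ^ 2 * (q i j * (1 - q i j)) ≤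
      ∫ ω, ‖noiseGram P A ω - matrixExpectation P (noiseGram P A)‖ ^ 2 ∂P := by
  rw [← integral_noiseGram_diag_sub_sq hA hind i]
  refine integral_mono_of_nonneg (ae_of_all _ fun ω => sq_nonneg _)
    (integrable_norm_noiseGram_sub_sq hA _) (ae_of_all _ fun ω => ?_)
  have h := abs_entry_le_l2_opNorm (noiseGram P A ω - matrixExpectation P (noiseGram P A)) i i
  rw [Matrix.sub_apply] at h
  exact sq_le_sq.2 (h.trans (le_abs_self _))

end noise

/-- If one label were absent, the imbalance `|a - b| / n` would equal 1. -/
lemma exists_label_eq {n a b : ℕ} {η : Fin n → ℤˣ} {γ : ℝ}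
    (ha : (Finset.univ.filter fun i => η i = 1).card = a)
    (hb : (Finset.univ.filter fun i => η i = -1).card = b) (hn : 0 < n) (hγ : γ < 1)
    (h : |(a : ℝ) - b| / n ≤ γ) (ε : ℤˣ) : ∃ i, η i = ε := by
  have hn' : (0 : ℝ) < n := by exact_mod_cast hn
  have hlt : |(a : ℝ) - b| < n := by
    have := (div_le_iff₀ hn').1 h
    nlinarith
  have hsum : a + b = n := by
    have h1 := Finset.card_filter_add_card_filter_not (s := (Finset.univ : Finset (Fin n)))
      (fun i => η i = 1)
    rw [ha, Finset.card_univ, Fintype.card_fin] at h1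
    rw [← h1, ← hb]
    congr 2
    ext i
    rcases Int.units_eq_one_or (η i) with h | h <;> simp [h]
  have hsum' : (a : ℝ) + b = n := by exact_mod_cast hsum
  rw [abs_lt] at hlt
  rcases Int.units_eq_one_or ε with rfl | rfl
  · have : 0 < a := by
      have : (0 : ℝ) < a := by linarith
      exact_mod_cast this
    obtain ⟨i, hi⟩ := Finset.card_pos.1 (ha.symm ▸ this)
    exact ⟨i, (Finset.mem_filter.1 hi).2⟩
  · have : 0 < b := by
      have : (0 : ℝ) < b := by linarith
      exact_mod_cast this
    obtain ⟨i, hi⟩ := Finset.card_pos.1 (hb.symm ▸ this)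
    exact ⟨i, (Finset.mem_filter.1 hi).2⟩


/-- Here `‖·‖` is the spectral norm (the `ℓ²` operator norm) of a square matrix. -/
theorem proposition2 {Ω : Type*} [MeasurableSpace Ω] (P : Measure Ω) [IsProbabilityMeasure P]
    (n₁ n₂ n₁p n₁m n₂p n₂m : ℕ) (δ p γ₁ γ₂ : ℝ)
    (η₁ : Fin n₁ → ℤˣ) (η₂ : Fin n₂ → ℤˣ) (A : Ω → Matrix (Fin n₁) (Fin n₂) ℝ)
    (hn₁ : 2 ≤ n₁) (hδ : δ ∈ Set.Ioo (0 : ℝ) 2)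
    (hγ₁ : γ₁ ∈ Set.Ioo (0 : ℝ) 1) (hγ₂ : γ₂ ∈ Set.Ioo (0 : ℝ) 1)
    (himb₁ : |(n₁p : ℝ) - (n₁m : ℝ)| / (n₁ : ℝ) ≤ γ₁)
    (himb₂ : |(n₂p : ℝ) - (n₂m : ℝ)| / (n₂ : ℝ) ≤ γ₂)
    (hA : IsBSBM P δ n₁p n₁m n₂p n₂m p η₁ η₂ A)
    (hn₂ : (n₁ : ℝ) * Real.log n₁ ≤ (n₂ : ℝ))
    (hp_lower : 18 * Real.sqrt (Real.log n₁ / ((n₁ : ℝ) * (n₂ : ℝ))) ≤ p)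
    (hp_upper : p ≤ 1 / (206 * (n₁ : ℝ) * Real.log n₁)) :
    (n₂ : ℝ) * p / 40 ≤
      ∫ ω, ‖noiseGram P A ω - matrixExpectation P (noiseGram P A)‖ ^ 2 ∂P := by
  set q : Fin n₁ → Fin n₂ → ℝ := fun i j => if η₁ i = η₂ j then δ * p else (2 - δ) * p with hq
  have hB : ∀ i j, IsBernoulli (fun ω => A ω i j) (q i j) P := fun i j => by
    by_cases h : η₁ i = η₂ j
    · simpa [hq, h] using hA.law_same i j h
    · simpa [hq, h] using hA.law_diff i j h
  have hp0 : 0 ≤ p := le_trans (by positivity) hp_lower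
  have hn₁' : (2 : ℝ) ≤ n₁ := by exact_mod_cast hn₁
  have hlog : 1 / 2 ≤ Real.log n₁ := by
    have := Real.log_le_log (by norm_num) hn₁'
    linarith [Real.log_two_gt_d9]
  -- Here `n₁ * log n₁ ≥ 2 * (1 / 2) = 1`; then `q ≤ 2 * p ≤ 1 / 103`.
  have hp : p ≤ 1 / 206 := hp_upper.trans
    (one_div_le_one_div_of_le (by norm_num) (by nlinarith))
  obtain ⟨hδ0, hδ2⟩ := hδ
  have hq0 : ∀ i j, 0 ≤ q i j := fun i j => by
    simp only [hq]; split_ifs <;> nlinarith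
  have hq1 : ∀ i j, q i j ≤ 1 / 100 := fun i j => by
    simp only [hq]; split_ifs <;> nlinarith
  have hrow : ∀ i, (∑ j, q i j) / 40 ≤
      ∫ ω, ‖noiseGram P A ω - matrixExpectation P (noiseGram P A)‖ ^ 2 ∂P := fun i => by
    refine le_trans ?_ (sum_variance_le_integral_norm_sq hB hA.indep i)
    rw [Finset.sum_div]
    refine Finset.sum_le_sum fun j _ => ?_
    have h0 := hq0 i j
    have h1 := hq1 i j
    have h2 : 9 / 10 ≤ (1 - 2 * q i j) ^ 2 := by nlinarith
    have h3 : q i j / 2 ≤ q i j * (1 - q i j) := by nlinarith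
    nlinarith
  obtain ⟨i, hi⟩ := exists_label_eq hA.card_left_plus hA.card_left_minus (by lia) hγ₁.2 himb₁ 1
  obtain ⟨k, hk⟩ := exists_label_eq hA.card_left_plus hA.card_left_minus (by lia) hγ₁.2 himb₁ (-1)
  -- In each column one of the two rows has mean `δ * p` and the other `(2 - δ) * p`.
  have hsum : ∑ j, q i j + ∑ j, q k j = 2 * (n₂ * p) := by
    rw [← Finset.sum_add_distrib, Finset.sum_congr rfl (g := fun _ => 2 * p)]
    · simp; ring
    · intro j _
      simp only [hq, hi, hk]
      rcases Int.units_eq_one_or (η₂ j) with h | h <;> simp [h] <;> ring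
  linarith [hrow i, hrow k]
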